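/- **Terminology.** Let $X$ be a countably infinite set of variables; assignments are functions $X\to\{0,1\}$. An *NNF* is a finite node-labelled directed acyclic graph with a unique sink (the output gate), whose sources are labelled by constants $0,1$ or by literals $x$, $\neg x$ ($x\in X$) and whose other nodes are labelled by $\wedge$ or $\vee$; it is evaluated in the usual way. Its *size* is its number of wires (arcs). It is a *DNNF* if for every $\wedge$-gate $v$ and any two distinct gates $u,u'$ with wires into $v$, the subcircuits with outputs $u$ and $u'$ have disjoint sets of variables. A *clause* is a finite set (disjunction) of literals, and a *CNF* $F$ is a finite set (conjunction) of clauses; $\mathrm{size}(F)=\sum_{K\in F}(|K|+1)$ is its number of wires as a depth-two circuit. A DNNF is equivalent to $F$ if both have the same value under every assignment. $F$ is in *prime implicates form* (PI) if no clause of $F$ contains a variable together with its negation, every clause without complementary literals that is entailed by $F$ contains a clause of $F$, and no clause of $F$ is contained in another clause of $F$. **Statement.** There exist a class $\mathcal C$ of CNFs in PI form, containing formulas of arbitrarily large size, and a constant $c>0$ such that for every $F\in\mathcal C$, every DNNF equivalent to $F$ has size at least $2^{c\cdot\mathrm{size}(F)}$. In particular, there is no polynomial $p$ such that every CNF $F$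 in PI form has an equivalent DNNF of size at most $p(\mathrm{size}(F))$ (that is, DNNF is not at least as succinct as PI). -/

import Mathlib

/-- A literal over the variables `X`: the variable `var` if `pos = true`, its negation otherwise. -/
structure Literal (X : Type*) where
  var : X
  pos : Bool

/-- The value of a literal under an assignment. -/
def Literal.eval {X : Type*} (f : X → Bool) (l : Literal X) : Bool :=
  if l.pos then f l.var else !f l.var

/-- Labels of the gates of a circuit in negation normal form: constants and literals
(for input gates), `∧` and `∨` (for internal gates). -/
inductive GateLabel (X : Type*) where
  | const (b : Bool) : GateLabel X
  | lit (l : Literal X) : GateLabel X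
  | and : GateLabel X
  | or : GateLabel X

/-- The labels that input gates carry. -/
def GateLabel.IsInput {X : Type*} : GateLabel X → Prop
  | const _ => True
  | lit _ => True
  | and => False
  | or => False

/-- A negation normal form: a finite node-labelled directed acyclic graph with a unique sink,
whose sources are labelled by constants or literals and whose other nodes are labelled by
`∧` or `∨`. `Wire u v` says that there is a wire from `u` to `v`. -/
structure NNF (X : Type*) where
  Gate : Type
  finite_gate : Finite Gate
  Wire : Gate → Gate → Prop
  acyclic : ∀ v, ¬ Relation.TransGen Wire v v
  output : Gate
  sink_iff : ∀ v, (∀ w, ¬ Wire v w) ↔ v = output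
  label : Gate → GateLabel X
  source_iff : ∀ v, (∀ u, ¬ Wire u v) ↔ (label v).IsInput

namespace NNF

variable {X : Type*}

theorem wire_wf (C : NNF X) : WellFounded C.Wire := by
  have := C.finite_gate
  have : Std.Irrefl (Relation.TransGen C.Wire) := ⟨C.acyclic⟩
  exact Subrelation.wf (fun h => Relation.TransGen.single h)
    (Finite.wellFounded_of_trans_of_irrefl (Relation.TransGen C.Wire))

/-- The number of wires. -/
noncomputable def size (C : NNF X) : ℕ :=
  Set.ncard {w : C.Gate × C.Gate | C.Wire w.1 w.2}

open Classical in
/-- The value, under the assignment `f`, of the subcircuit sinked at a gate, by recursion along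
the wires. -/
noncomputable def value (C : NNF X) (f : X → Bool) : C.Gate → Bool :=
  C.wire_wf.fix fun v ih =>
    match C.label v with
    | .const b => b
    | .lit l => l.eval f
    | .and => decide (∀ (u : C.Gate) (h : C.Wire u v), ih u h = true)
    | .or => decide (∃ (u : C.Gate) (h : C.Wire u v), ih u h = true)

open Classical in
theorem value_eq (C : NNF X) (f : X → Bool) (v : C.Gate) :
    C.value f v =
      match C.label v with
      | .const b => b
      | .lit l => l.eval f
      | .and => decide (∀ u : C.Gate, C.Wire u v → C.value f u = true)
      | .or => decide (∃ u : C.Gate, C.Wire u v ∧ C.value f u = true) := by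
  unfold value
  rw [WellFounded.fix_eq]
  simp only [exists_prop]

/-- The value of the circuit under an assignment. -/
noncomputable def eval (C : NNF X) (f : X → Bool) : Bool :=
  C.value f C.output

/-- The variables of the subcircuit sinked at `v`: those in the labels of the input gates from
which there is a (possibly empty) directed path to `v`. -/
def varsSub (C : NNF X) (v : C.Gate) : Set X :=
  {x | ∃ u, Relation.ReflTransGen C.Wire u v ∧ ∃ b, C.label u = .lit ⟨x, b⟩}

/-- An NNF is a DNNF if the subcircuits leading into an `∧`-gate from distinct gates have
disjoint sets of variables. -/
def IsDNNF (C : NNF X) : Prop :=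
  ∀ v, C.label v = .and → ∀ u u', C.Wire u v → C.Wire u' v → u ≠ u' →
    Disjoint (C.varsSub u) (C.varsSub u')

end NNF

/-- A clause: a finite disjunction of literals. -/
abbrev Clause (X : Type*) := Finset (Literal X)

namespace Clause

variable {X : Type*}

/-- `f` satisfies the clause. -/
def Holds (f : X → Bool) (K : Clause X) : Prop :=
  ∃ l ∈ K, l.eval f = true

/-- The clause contains no variable together with its negation. -/
def Nontautological (K : Clause X) : Prop :=
  ∀ x : X, ¬ ((⟨x, true⟩ : Literal X) ∈ K ∧ (⟨x, false⟩ : Literal X) ∈ K)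

end Clause

/-- A CNF: a finite conjunction of clauses. -/
abbrev CNF (X : Type*) := Finset (Clause X)

namespace CNF

variable {X : Type*}

open Classical in
/-- The value of a CNF under an assignment. -/
noncomputable def eval (F : CNF X) (f : X → Bool) : Bool :=
  decide (∀ K ∈ F, Clause.Holds f K)

/-- The number of wires of a CNF seen as a circuit of depth two: each clause is an `∨`-gate with
one wire to the output `∧`-gate and one wire from each of its literals. -/
def size (F : CNF X) : ℕ :=
  ∑ K ∈ F, (K.card + 1)

/-- Every assignment that satisfies `F` satisfies the clause `K`. -/
def Entails (F : CNF X) (K : Clause X) : Prop :=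
  ∀ f : X → Bool, F.eval f = true → Clause.Holds f K

/-- Prime implicates form: every entailed clause is subsumed by a clause of `F`, and no clause of
`F` is subsumed by another one. Here, as usual for (prime) implicates, a clause does not contain
complementary literals. -/
def IsPI (F : CNF X) : Prop :=
  (∀ K ∈ F, Clause.Nontautological K) ∧
  (∀ K : Clause X, Clause.Nontautological K → F.Entails K → ∃ K' ∈ F, K' ⊆ K) ∧
  (∀ K ∈ F, ∀ K' ∈ F, K' ⊆ K → K' = K)

end CNF

/-- The circuit `D` and the CNF `F` have the same value under every assignment. -/
def NNF.EquivalentTo {X : Type*} (D : NNF X) (F : CNF X) : Prop :=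
  ∀ f : X → Bool, D.eval f = F.eval f

/-! The hard formulas say "this is a vertex cover of `G`", where `G` has `12 * t` vertices, at most
`600 * t` edges, and an edge between any two disjoint sets of `2 * t` vertices
(`exists_joinsLargeSets`, by counting). Being monotone with an antichain of clauses, they are in PI
form. A DNNF with `s` wires covers its models by at most `2 * s + 1` rectangles, each for a
partition with at least a third of the vertices on either side (`NNF.exists_rectangle_cover`). If
`p` and `q` are adjacent and on different sides, then `p` or `q` is true throughout the rectangle:
otherwise two of its members could be mixed into a non-model. So the unforced vertices on the two
sides are not adjacent, and the edge property leaves `t` forced vertices of bounded degree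
(`exists_forced_vertices`). Complements of vertex covers are independent sets, and each vertex of
degree at most `d` that must be avoided costs a factor `2 ^ d / (2 ^ d + 1)` in their number
(`card_indepAvoiding_le`). Each rectangle thus holds an exponentially small share of the models, so
exponentially many are needed. -/

/-- `R` is a combinatorial rectangle for the partition of the variables into `S` and `Sᶜ`. -/
def Rectangular {X : Type*} (S : Set X) (R : Set (X → Bool)) : Prop :=
  ∀ f ∈ R, ∀ g ∈ R, ∀ h : X → Bool, Set.EqOn h f S → Set.EqOn h g Sᶜ → h ∈ R

/-! ### Weights of sets of variables -/

/-- The number of indices `a` such that the variable `ι a` lies in `S`. -/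
noncomputable def weight {X α : Type*} (ι : α → X) (S : Set X) : ℕ :=
  (ι ⁻¹' S).ncard

section weight

variable {X α : Type*} [Finite α]

theorem weight_mono (ι : α → X) {S T : Set X} (h : S ⊆ T) : weight ι S ≤ weight ι T :=
  Set.ncard_le_ncard (Set.preimage_mono h)

omit [Finite α] in
theorem weight_union_le (ι : α → X) (S T : Set X) :
    weight ι (S ∪ T) ≤ weight ι S + weight ι T := by
  unfold weight
  rw [Set.preimage_union]
  exact Set.ncard_union_le _ _

theorem weight_le_one (ι : α ↪ X) {S : Set X} (h : S.Subsingleton) : weight ι S ≤ 1 :=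
  (Set.ncard_le_one).2 fun _ ha _ hb => ι.injective (h ha hb)

omit [Finite α] in
theorem exists_weight_eq (ι : α ↪ X) {A B : Set X} (hAB : A ⊆ B) {k : ℕ}
    (hA : weight ι A ≤ k) (hB : k ≤ weight ι B) :
    ∃ S, A ⊆ S ∧ S ⊆ B ∧ weight ι S = k := by
  obtain ⟨T, hAT, hTB, hT⟩ :=
    Set.exists_subsuperset_card_eq (Set.preimage_mono (f := ι) hAB) hA hB
  refine ⟨A ∪ ι '' T, Set.subset_union_left, Set.union_subset hAB ?_, ?_⟩
  · rintro _ ⟨a, ha, rfl⟩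
    exact hTB ha
  · have : ι ⁻¹' (A ∪ ι '' T) = T := by
      rw [Set.preimage_union, Set.preimage_image_eq _ ι.injective]
      exact Set.union_eq_right.2 hAT
    rw [weight, this, hT]

end weight

/-! ### Balanced rectangle covers from DNNFs -/

namespace NNF

variable {X : Type*} {C : NNF X} {f g : X → Bool} {u v : C.Gate}

theorem varsSub_mono (h : C.Wire u v) : C.varsSub u ⊆ C.varsSub v := by
  rintro x ⟨w, hw, hx⟩
  exact ⟨w, hw.tail h, hx⟩

theorem label_ne_input_of_wire (h : C.Wire u v) : ¬ (C.label v).IsInput := fun hv =>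
  (C.source_iff v).2 hv u h

theorem exists_wire_mem_varsSub {x : X} (hv : ¬ (C.label v).IsInput) (hx : x ∈ C.varsSub v) :
    ∃ u, C.Wire u v ∧ x ∈ C.varsSub u := by
  obtain ⟨w, hw, b, hb⟩ := hx
  rcases hw.cases_tail with rfl | ⟨u, hwu, huv⟩
  · exact absurd (by rw [hb]; trivial) hv
  · exact ⟨u, huv, w, hwu, b, hb⟩

theorem varsSub_subsingleton_of_isInput (hv : (C.label v).IsInput) :
    (C.varsSub v).Subsingleton := by
  have key : ∀ x ∈ C.varsSub v, ∃ b, C.label v = .lit ⟨x, b⟩ := by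
    rintro x ⟨w, hw, b, hb⟩
    rcases hw.cases_tail with rfl | ⟨u, -, huv⟩
    · exact ⟨b, hb⟩
    · exact absurd hv (label_ne_input_of_wire huv)
  intro x hx y hy
  obtain ⟨b, hb⟩ := key x hx
  obtain ⟨b', hb'⟩ := key y hy
  rw [hb] at hb'
  simp only [GateLabel.lit.injEq, Literal.mk.injEq] at hb'
  exact hb'.1

theorem value_and (h : C.label v = .and) :
    C.value f v = true ↔ ∀ u, C.Wire u v → C.value f u = true := by
  rw [value_eq, h]; simp

theorem value_or (h : C.label v = .or) :
    C.value f v = true ↔ ∃ u, C.Wire u v ∧ C.value f u = true := by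
  rw [value_eq, h]; simp

theorem value_congr (h : Set.EqOn f g (C.varsSub v)) : C.value f v = C.value g v := by
  induction v using C.wire_wf.induction with
  | _ v ih =>
    have ih' : ∀ u, C.Wire u v → C.value f u = C.value g u := fun u hu =>
      ih u hu (h.mono (varsSub_mono hu))
    cases hl : C.label v with
    | const b => rw [value_eq, value_eq, hl]
    | lit l =>
      rw [value_eq, value_eq, hl]
      have : f l.var = g l.var := h ⟨v, .refl, l.pos, hl⟩
      simp only [Literal.eval, this]
    | and =>
      rw [Bool.eq_iff_iff, value_and hl, value_and hl]
      exact forall₂_congr fun u hu => by rw [ih' u hu]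
    | or =>
      rw [Bool.eq_iff_iff, value_or hl, value_or hl]
      exact exists_congr fun u => and_congr_right fun hu => by rw [ih' u hu]

/-- There is a path from the gate to the output along which the side inputs of all `∧`-gates
are true under `f`. -/
inductive Context (C : NNF X) (f : X → Bool) : C.Gate → Prop
  | output : Context C f C.output
  | step {u v : C.Gate} (huv : C.Wire u v) (hv : Context C f v)
      (hs : C.label v = .and → ∀ w, C.Wire w v → w ≠ u → C.value f w = true) : Context C f u

/-- Decomposability makes the side inputs on the path share no variable with the subcircuit at `v`,
so that path still works after any change inside `C.varsSub v`. -/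
theorem Context.congr (hC : C.IsDNNF) (hv : C.Context f v)
    (h : Set.EqOn f g (C.varsSub v)ᶜ) : C.Context g v := by
  induction hv with
  | output => exact .output
  | @step u v huv _ hs ih =>
    refine .step huv (ih (h.mono (Set.compl_subset_compl.2 (varsSub_mono huv)))) ?_
    intro hl w hw hwu
    rw [← hs hl w hw hwu]
    refine (value_congr (h.mono ?_)).symm
    exact (hC v hl w u hw huv hwu).subset_compl_right

theorem Context.eval_eq_true (hv : C.Context f v) (h : C.value f v = true) :
    C.eval f = true := by
  induction hv with
  | output => exact h
  | @step u v huv _ hs ih =>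
    apply ih
    cases hl : C.label v with
    | const b => exact absurd (by rw [hl]; trivial) (label_ne_input_of_wire huv)
    | lit l => exact absurd (by rw [hl]; trivial) (label_ne_input_of_wire huv)
    | and =>
      rw [value_and hl]
      intro w hw
      by_cases hwu : w = u
      · rwa [hwu]
      · exact hs hl w hw hwu
    | or => exact (value_or hl).2 ⟨u, huv, h⟩

/-- The assignments for which the gate is part of a certificate of the output. -/
def gateRect (C : NNF X) (v : C.Gate) : Set (X → Bool) :=
  {f | C.Context f v ∧ C.value f v = true}

/-- The assignments for which the wire is part of a certificate of the output. -/
def wireRect (C : NNF X) (u v : C.Gate) : Set (X → Bool) :=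
  {f | C.Context f v ∧ C.value f u = true}

/-- The context of `v` reads only variables outside `C.varsSub v`, and the value at `u` only those
in `C.varsSub u`; the variables in between are free. This freedom lets `S` be tuned to a prescribed
weight. -/
theorem rectangular_wireRect (hC : C.IsDNNF) {S : Set X} (hu : C.varsSub u ⊆ S)
    (hv : S ⊆ C.varsSub v) : Rectangular S (C.wireRect u v) := by
  rintro f ⟨-, hf⟩ g ⟨hg, -⟩ h hhf hhg
  refine ⟨hg.congr hC (hhg.mono (Set.compl_subset_compl.2 hv)).symm, ?_⟩
  rw [← hf]
  exact value_congr (hhf.mono hu)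

theorem rectangular_gateRect_output {S : Set X} (hS : C.varsSub C.output ⊆ S) :
    Rectangular S (C.gateRect C.output) := by
  rintro f ⟨-, hf⟩ g - h hhf -
  refine ⟨.output, ?_⟩
  rw [← hf]
  exact value_congr (hhf.mono hS)

theorem rectangular_gateRect (hC : C.IsDNNF) (hv : C.label v = .and) {U : Set C.Gate}
    (hU : ∀ u ∈ U, C.Wire u v) : Rectangular (⋃ u ∈ U, C.varsSub u) (C.gateRect v) := by
  rintro f ⟨-, hf⟩ g ⟨hg, hgv⟩ h hhf hhg
  constructor
  · refine hg.congr hC (hhg.mono (Set.compl_subset_compl.2 ?_)).symm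
    exact Set.iUnion₂_subset fun u hu => varsSub_mono (hU u hu)
  · rw [value_and hv] at hf hgv ⊢
    intro w hw
    by_cases hwU : w ∈ U
    · rw [← hf w hw]
      exact value_congr (hhf.mono (Set.subset_biUnion_of_mem hwU))
    · rw [← hgv w hw]
      refine value_congr (hhg.mono ?_)
      rw [Set.subset_compl_iff_disjoint_right, Set.disjoint_iUnion₂_right]
      intro u hu
      exact hC v hv w u hw (hU u hu) fun h => hwU (h ▸ hu)

/-- A rectangle inside the models of `C` whose partition splits the variables `ι` in a balanced
way. -/
def BalancedRect {α : Type*} (C : NNF X) (ι : α → X) (k : ℕ) (R : Set (X → Bool)) : Prop :=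
  (∀ f ∈ R, C.eval f = true) ∧
    ∃ S : Set X, k ≤ weight ι S ∧ weight ι S ≤ 2 * k ∧ Rectangular S R

section cover

variable {α : Type*} [Finite α] {ι : α ↪ X} {k : ℕ}

omit [Finite α] in
theorem balancedRect_wireRect (hC : C.IsDNNF) (hl : C.label v = .or) (huv : C.Wire u v)
    (hu : weight ι (C.varsSub u) < 2 * k) (hv : 2 * k ≤ weight ι (C.varsSub v)) :
    C.BalancedRect ι k (C.wireRect u v) := by
  refine ⟨fun f hf => hf.1.eval_eq_true ((value_or hl).2 ⟨u, huv, hf.2⟩), ?_⟩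
  obtain ⟨S, h1, h2, h3⟩ := exists_weight_eq ι (varsSub_mono huv) hu.le hv
  exact ⟨S, by omega, by omega, rectangular_wireRect hC h1 h2⟩

theorem balancedRect_gateRect (hC : C.IsDNNF) (hl : C.label v = .and)
    (hu : ∀ u, C.Wire u v → weight ι (C.varsSub u) < 2 * k)
    (hv : 2 * k ≤ weight ι (C.varsSub v)) (hk : 0 < k) :
    C.BalancedRect ι k (C.gateRect v) := by
  have := C.finite_gate
  refine ⟨fun f hf => hf.1.eval_eq_true hf.2, ?_⟩
  have hne : {U : Set C.Gate | (∀ u ∈ U, C.Wire u v) ∧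
      k ≤ weight ι (⋃ u ∈ U, C.varsSub u)}.Nonempty := by
    refine ⟨{u | C.Wire u v}, fun u hu => hu, ?_⟩
    have : C.varsSub v ⊆ ⋃ u ∈ {u | C.Wire u v}, C.varsSub u := by
      intro x hx
      obtain ⟨u, hu, hxu⟩ := exists_wire_mem_varsSub (by rw [hl]; exact id) hx
      exact Set.mem_biUnion (show u ∈ {u | C.Wire u v} from hu) hxu
    have := weight_mono ι this
    omega
  -- A minimal family of inputs of weight at least `k` does not overshoot `2 * k`: it is a single
  -- input, or dropping one input of weight below `k` leaves weight below `k`.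
  obtain ⟨U, hU⟩ := (Set.toFinite _).exists_minimal hne
  obtain ⟨⟨hUw, hUk⟩, hmin⟩ := hU
  refine ⟨_, hUk, ?_, rectangular_gateRect hC hl hUw⟩
  rcases U.eq_empty_or_nonempty with rfl | ⟨u, huU⟩
  · simp [weight]
  by_cases huk : k ≤ weight ι (C.varsSub u)
  · have hsub : U ⊆ {u} := hmin ⟨by simpa using hUw u huU, by simpa using huk⟩ (by simpa using huU)
    have := weight_mono ι (Set.biUnion_subset_biUnion_left (t := C.varsSub) hsub)
    have h2 := hu u (hUw u huU)
    simp only [Set.mem_singleton_iff, Set.iUnion_iUnion_eq_left] at this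
    omega
  · have hlt : weight ι (⋃ w ∈ U \ {u}, C.varsSub w) < k := by
      by_contra! hcon
      have := hmin (y := U \ {u}) ⟨fun w hw => hUw w hw.1, hcon⟩ Set.sdiff_subset huU
      simp at this
    have hun : (⋃ w ∈ U, C.varsSub w) = C.varsSub u ∪ ⋃ w ∈ U \ {u}, C.varsSub w := by
      rw [← Set.biUnion_insert, Set.insert_sdiff_singleton, Set.insert_eq_of_mem huU]
    rw [hun]
    have := weight_union_le ι (C.varsSub u) (⋃ w ∈ U \ {u}, C.varsSub w)
    omega

/-- Descend through true gates of weight at least `2 * k` until the next step would leave them. A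
descent stopping at an `∨`-gate yields a wire rectangle, one stopping at an `∧`-gate a gate
rectangle; gates of unbounded fan-in need no preprocessing. -/
theorem exists_balancedRect_of_context (hC : C.IsDNNF) (hk : 0 < k) (hf : C.Context f v)
    (hfv : C.value f v = true) (hv : 2 * k ≤ weight ι (C.varsSub v)) :
    (∃ u v, C.Wire u v ∧ C.BalancedRect ι k (C.wireRect u v) ∧ f ∈ C.wireRect u v) ∨
      ∃ v, C.BalancedRect ι k (C.gateRect v) ∧ f ∈ C.gateRect v := by
  induction v using C.wire_wf.induction with
  | _ v ih =>
    have hinput : ¬ (C.label v).IsInput := fun h => by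
      have := weight_le_one ι (varsSub_subsingleton_of_isInput h)
      omega
    cases hl : C.label v with
    | const b => exact absurd (by rw [hl]; trivial) hinput
    | lit l => exact absurd (by rw [hl]; trivial) hinput
    | and =>
      by_cases hbig : ∃ u, C.Wire u v ∧ 2 * k ≤ weight ι (C.varsSub u)
      · obtain ⟨u, huv, hu⟩ := hbig
        have hall := (value_and hl).1 hfv
        exact ih u huv (.step huv hf fun _ w hw _ => hall w hw) (hall u huv) hu
      · push Not at hbig
        exact .inr ⟨v, balancedRect_gateRect hC hl hbig hv hk, hf, hfv⟩
    | or =>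
      obtain ⟨u, huv, hfu⟩ := (value_or hl).1 hfv
      by_cases hu : 2 * k ≤ weight ι (C.varsSub u)
      · exact ih u huv (.step huv hf fun h => by simp [hl] at h) hfu hu
      · exact .inl ⟨u, v, huv, balancedRect_wireRect hC hl huv (not_le.1 hu) hv, hf, hfu⟩

theorem exists_balancedRect (hC : C.IsDNNF) (hk : 0 < k) (hα : 2 * k ≤ Nat.card α)
    (hf : C.eval f = true) :
    (∃ u v, C.Wire u v ∧ C.BalancedRect ι k (C.wireRect u v) ∧ f ∈ C.wireRect u v) ∨
      ∃ v, C.BalancedRect ι k (C.gateRect v) ∧ f ∈ C.gateRect v := by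
  by_cases hv : 2 * k ≤ weight ι (C.varsSub C.output)
  · exact exists_balancedRect_of_context hC hk .output hf hv
  · have huniv : weight ι (Set.univ : Set X) = Nat.card α := by
      simp [weight, Set.ncard_univ]
    -- The circuit mentions too few variables for a descent, so its set of variables is padded with
    -- unused ones.
    obtain ⟨S, h1, -, h3⟩ := exists_weight_eq ι (Set.subset_univ (C.varsSub C.output))
      (k := 2 * k) (by omega) (by omega)
    exact .inr ⟨C.output, ⟨fun f hf => hf.1.eval_eq_true hf.2, S, by omega, by omega,
      rectangular_gateRect_output h1⟩, .output, hf⟩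

theorem card_gate_le (C : NNF X) : Nat.card C.Gate ≤ C.size + 1 := by
  have := C.finite_gate
  have h : (Set.univ : Set C.Gate) ⊆
      insert C.output (Prod.fst '' {w : C.Gate × C.Gate | C.Wire w.1 w.2}) := by
    intro v _
    by_cases hv : v = C.output
    · exact .inl hv
    · have := mt (C.sink_iff v).1 hv
      push Not at this
      obtain ⟨w, hw⟩ := this
      exact .inr ⟨(v, w), hw, rfl⟩
  rw [← Set.ncard_univ]
  calc _ ≤ _ := Set.ncard_le_ncard h
    _ ≤ _ := Set.ncard_insert_le _ _
    _ ≤ C.size + 1 := Nat.add_le_add_right (Set.ncard_image_le) 1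

/-- The models of a DNNF are covered by few balanced rectangles. -/
theorem exists_rectangle_cover (hC : C.IsDNNF) (hk : 0 < k) (hα : 2 * k ≤ Nat.card α) :
    ∃ 𝓡 : Finset (Set (X → Bool)), 𝓡.card ≤ 2 * C.size + 1 ∧
      (∀ R ∈ 𝓡, C.BalancedRect ι k R) ∧ ∀ f, C.eval f = true → ∃ R ∈ 𝓡, f ∈ R := by
  have := C.finite_gate
  let A : Set (Set (X → Bool)) :=
    (fun w : C.Gate × C.Gate => C.wireRect w.1 w.2) '' {w | C.Wire w.1 w.2}
  let B : Set (Set (X → Bool)) := C.gateRect '' Set.univ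
  have hfin : (A ∪ B).Finite := Set.toFinite _
  have hsub : {R | R ∈ A ∪ B ∧ C.BalancedRect ι k R} ⊆ A ∪ B := fun R hR => hR.1
  have hfin' := hfin.subset hsub
  refine ⟨hfin'.toFinset, ?_, fun R hR => ((hfin'.mem_toFinset).1 hR).2, fun f hf => ?_⟩
  · rw [← Set.ncard_eq_toFinset_card _ hfin']
    have h1 := Set.ncard_le_ncard hsub hfin
    have h2 := Set.ncard_union_le A B
    have h3 : A.ncard ≤ C.size := Set.ncard_image_le
    have h4 : B.ncard ≤ Nat.card C.Gate := by
      rw [← Set.ncard_univ]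
      exact Set.ncard_image_le
    have h5 := C.card_gate_le
    omega
  · rcases exists_balancedRect (ι := ι) hC hk hα hf with ⟨u, v, huv, hR, hfR⟩ | ⟨v, hR, hfR⟩
    · exact ⟨_, hfin'.mem_toFinset.2 ⟨.inl ⟨(u, v), huv, rfl⟩, hR⟩, hfR⟩
    · exact ⟨_, hfin'.mem_toFinset.2 ⟨.inr ⟨v, trivial, rfl⟩, hR⟩, hfR⟩

end cover

end NNF

/-! ### Independent sets avoiding prescribed vertices -/

namespace SimpleGraph

section independent

variable {α : Type*} [Fintype α] [DecidableEq α] (G : SimpleGraph α)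

open Classical in
/-- The independent sets of `G` that avoid `W`. -/
noncomputable def indepAvoiding (W : Finset α) : Finset (Finset α) :=
  {I | G.IsIndepSet (I : Set α) ∧ Disjoint I W}

variable {G}

theorem mem_indepAvoiding {W I : Finset α} :
    I ∈ G.indepAvoiding W ↔ G.IsIndepSet (I : Set α) ∧ Disjoint I W := by
  simp [indepAvoiding]

variable [DecidableRel G.Adj]

/-- An independent set without `w` is recovered from its trace on the neighbours of `w` and the
independent set obtained by replacing that trace with `w`. Hence sets without `w` outnumber those
with `w` by a factor of at most `2 ^ d`. -/
theorem card_indepAvoiding_insert {W : Finset α} {w : α} {d : ℕ} (hw : w ∉ W)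
    (hd : G.degree w ≤ d) :
    (2 ^ d + 1) * (G.indepAvoiding (insert w W)).card ≤ 2 ^ d * (G.indepAvoiding W).card := by
  set A := G.indepAvoiding (insert w W)
  set B := (G.indepAvoiding W).filter (w ∈ ·)
  have hA : (G.indepAvoiding W).filter (w ∉ ·) = A := by
    ext I
    simp only [A, Finset.mem_filter, mem_indepAvoiding, Finset.disjoint_insert_right]
    tauto
  have hcard : B.card + A.card = (G.indepAvoiding W).card := by
    rw [← hA]
    exact Finset.card_filter_add_card_filter_not _
  have hle : A.card ≤ B.card * 2 ^ d := by
    calc A.card ≤ (B ×ˢ (G.neighborFinset w).powerset).card := by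
          refine Finset.card_le_card_of_injOn
            (fun I => (insert w (I \ G.neighborFinset w), I ∩ G.neighborFinset w)) ?_ ?_
          · intro I hI
            obtain ⟨hind, hdis⟩ := mem_indepAvoiding.1 hI
            rw [Finset.disjoint_insert_right] at hdis
            simp only [Finset.coe_product, Set.mem_prod, Finset.mem_coe, Finset.mem_powerset,
              Finset.inter_subset_right, and_true, B, Finset.mem_filter, mem_indepAvoiding,
              Finset.mem_insert_self, Finset.disjoint_insert_left]
            refine ⟨?_, hw, hdis.2.mono_left Finset.sdiff_subset⟩
            rw [Finset.coe_insert, isIndepSet_iff, Set.pairwise_insert]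
            refine ⟨hind.mono (by simp), fun b hb _ => ?_⟩
            have : ¬ G.Adj w b := by simpa using (Finset.mem_sdiff.1 hb).2
            exact ⟨this, fun h => this h.symm⟩
          · intro I hI J hJ hIJ
            have hI' := (mem_indepAvoiding.1 hI).2
            have hJ' := (mem_indepAvoiding.1 hJ).2
            rw [Finset.disjoint_insert_right] at hI' hJ'
            simp only [Prod.mk.injEq] at hIJ
            have h1 : I \ G.neighborFinset w = J \ G.neighborFinset w := by
              have := congrArg (Finset.erase · w) hIJ.1
              simpa [Finset.erase_insert, hI'.1, hJ'.1] using this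
            rw [← Finset.sdiff_union_inter I (G.neighborFinset w), h1, hIJ.2,
              Finset.sdiff_union_inter]
      _ = B.card * 2 ^ G.degree w := by
          rw [Finset.card_product, Finset.card_powerset, card_neighborFinset_eq_degree]
      _ ≤ B.card * 2 ^ d := by gcongr; norm_num
  rw [← hcard]
  nlinarith

theorem card_indepAvoiding_le {W : Finset α} {d : ℕ} (hW : ∀ w ∈ W, G.degree w ≤ d) :
    (2 ^ d + 1) ^ W.card * (G.indepAvoiding W).card ≤
      (2 ^ d) ^ W.card * (G.indepAvoiding ∅).card := by
  induction W using Finset.induction_on with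
  | empty => simp
  | insert w W hw ih =>
    rw [Finset.card_insert_of_notMem hw]
    have h1 := card_indepAvoiding_insert hw (hW w (Finset.mem_insert_self _ _))
    have h2 := ih fun v hv => hW v (Finset.mem_insert_of_mem hv)
    calc (2 ^ d + 1) ^ (W.card + 1) * (G.indepAvoiding (insert w W)).card
        = (2 ^ d + 1) ^ W.card * ((2 ^ d + 1) * (G.indepAvoiding (insert w W)).card) := by ring
      _ ≤ (2 ^ d + 1) ^ W.card * (2 ^ d * (G.indepAvoiding W).card) := by gcongr
      _ = 2 ^ d * ((2 ^ d + 1) ^ W.card * (G.indepAvoiding W).card) := by ring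
      _ ≤ 2 ^ d * ((2 ^ d) ^ W.card * (G.indepAvoiding ∅).card) := by gcongr
      _ = _ := by ring

omit [DecidableEq α] in
theorem card_high_degree_le {d m : ℕ} (hE : G.edgeFinset.card ≤ m) :
    d * (Finset.univ.filter fun v => d < G.degree v).card ≤ 2 * m := by
  have h := G.sum_degrees_eq_twice_card_edges
  calc d * (Finset.univ.filter fun v => d < G.degree v).card
      = ∑ v with d < G.degree v, d := by simp [mul_comm]
    _ ≤ ∑ v with d < G.degree v, G.degree v :=
        Finset.sum_le_sum fun v hv => (Finset.mem_filter.1 hv).2.le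
    _ ≤ ∑ v, G.degree v := Finset.sum_le_sum_of_subset (Finset.filter_subset _ _)
    _ ≤ 2 * m := by omega

end independent

/-! ### Sparse graphs joining all large sets -/

/-- Any two disjoint sets of at least `k` vertices are joined by an edge. -/
def JoinsLargeSets {α : Type*} (G : SimpleGraph α) (k : ℕ) : Prop :=
  ∀ P Q : Finset α, Disjoint P Q → k ≤ P.card → k ≤ Q.card → ∃ p ∈ P, ∃ q ∈ Q, G.Adj p q

/-- Union bound: a product `P ×ˢ Q` has at least `4 * t ^ 2` of the `144 * t ^ 2` pairs, so at most
`(140 * t ^ 2) ^ (600 * t)` sequences miss it, and there are at most `4 ^ (12 * t)` products. -/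
theorem exists_pairs_meeting_large_products (t : ℕ) (ht : 0 < t) :
    ∃ e : Fin (600 * t) → Fin (12 * t) × Fin (12 * t), ∀ P Q : Finset (Fin (12 * t)),
      2 * t ≤ P.card → 2 * t ≤ Q.card → ∃ i, e i ∈ P ×ˢ Q := by
  classical
  by_contra! hcon
  let bad : Finset (Fin (12 * t)) × Finset (Fin (12 * t)) →
      Finset (Fin (600 * t) → Fin (12 * t) × Fin (12 * t)) :=
    fun PQ => Fintype.piFinset fun _ => (PQ.1 ×ˢ PQ.2)ᶜ
  let pairs : Finset (Finset (Fin (12 * t)) × Finset (Fin (12 * t))) :=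
    {PQ | 2 * t ≤ PQ.1.card ∧ 2 * t ≤ PQ.2.card}
  have hcover : Finset.univ ⊆ pairs.biUnion bad := by
    intro e _
    obtain ⟨P, Q, hP, hQ, h⟩ := hcon e
    exact Finset.mem_biUnion.2 ⟨(P, Q), by simp [pairs, hP, hQ],
      Fintype.mem_piFinset.2 fun i => Finset.mem_compl.2 (h i)⟩
  have hbad : ∀ PQ ∈ pairs, (bad PQ).card ≤ (140 * t ^ 2) ^ (600 * t) := by
    intro PQ hPQ
    obtain ⟨h1, h2⟩ := (Finset.mem_filter.1 hPQ).2
    simp only [bad, Fintype.card_piFinset, Finset.prod_const, Finset.card_univ, Fintype.card_fin]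
    gcongr
    rw [Finset.card_compl, Finset.card_product, Fintype.card_prod, Fintype.card_fin]
    have := Nat.mul_le_mul h1 h2
    have h3 : 12 * t * (12 * t) = 140 * t ^ 2 + 2 * t * (2 * t) := by ring
    omega
  have hpairs : pairs.card ≤ 4 ^ (12 * t) := by
    refine (Finset.card_le_univ _).trans ?_
    rw [Fintype.card_prod, Fintype.card_finset, Fintype.card_fin, ← mul_pow]
    norm_num
  have h1 := (Finset.card_le_card hcover).trans (Finset.card_biUnion_le_card_mul _ _ _ hbad)
  have h2 := h1.trans (Nat.mul_le_mul_right _ hpairs)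
  rw [Finset.card_univ, Fintype.card_fun, Fintype.card_prod, Fintype.card_fin,
    Fintype.card_fin] at h2
  -- The `600 * t` samples are 50 per vertex, just enough for `4 * 140 ^ 50 < 144 ^ 50`.
  have h3 : (4 * 140 ^ 50) ^ (12 * t) < (144 ^ 50) ^ (12 * t) :=
    Nat.pow_lt_pow_left (by norm_num) (by omega)
  have h4 : 600 * t = 50 * (12 * t) := by ring
  have h5 : 12 * t * (12 * t) = 144 * t ^ 2 := by ring
  rw [h5, mul_pow, mul_pow, ← mul_assoc] at h2
  have h6 := Nat.le_of_mul_le_mul_right h2 (by positivity)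
  rw [h4, pow_mul 144, pow_mul 140, ← mul_pow] at h6
  exact absurd h6 (not_le.2 h3)

theorem exists_joinsLargeSets (t : ℕ) (ht : 0 < t) :
    ∃ G : SimpleGraph (Fin (12 * t)), G.JoinsLargeSets (2 * t) ∧ G.edgeSet.ncard ≤ 600 * t := by
  obtain ⟨e, he⟩ := exists_pairs_meeting_large_products t ht
  refine ⟨fromEdgeSet (Set.range fun i => s((e i).1, (e i).2)), ?_, ?_⟩
  · intro P Q hPQ hP hQ
    obtain ⟨i, hi⟩ := he P Q hP hQ
    obtain ⟨h1, h2⟩ := Finset.mem_product.1 hi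
    exact ⟨_, h1, _, h2, (fromEdgeSet_adj _).2
      ⟨⟨i, rfl⟩, Finset.disjoint_iff_ne.1 hPQ _ h1 _ h2⟩⟩
  · rw [edgeSet_fromEdgeSet, ← Set.image_univ]
    calc _ ≤ _ := Set.ncard_le_ncard Set.sdiff_subset
      _ ≤ _ := Set.ncard_image_le
      _ = 600 * t := by simp [Set.ncard_univ]

end SimpleGraph

/-! ### Monotone CNFs and prime implicates -/

namespace CNF

variable {X : Type*}

theorem eval_eq_true_iff (F : CNF X) (f : X → Bool) :
    F.eval f = true ↔ ∀ K ∈ F, Clause.Holds f K := by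
  simp [eval]

/-- A monotone CNF whose clauses form an antichain is in prime implicates form. -/
theorem isPI_of_monotone {F : CNF X} (hpos : ∀ K ∈ F, ∀ l ∈ K, l.pos = true)
    (hanti : ∀ K ∈ F, ∀ K' ∈ F, K' ⊆ K → K' = K) : F.IsPI := by
  classical
  refine ⟨fun K hK x hx => by simpa using hpos K hK _ hx.2, fun K hK hent => ?_, hanti⟩
  by_contra! hcon
  -- This assignment falsifies exactly the variables occurring positively in `K`. It falsifies `K`,
  -- but satisfies every clause of `F`, since each has a positive literal outside `K`.
  obtain ⟨l, hl, hval⟩ := hent (fun x => decide ((⟨x, true⟩ : Literal X) ∉ K)) <| by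
    rw [eval_eq_true_iff]
    intro K' hK'
    obtain ⟨l, hl, hlK⟩ := Finset.not_subset.1 (hcon K' hK')
    have hp := hpos K' hK' l hl
    obtain ⟨x, b⟩ := l
    obtain rfl : b = true := hp
    exact ⟨_, hl, by simpa [Literal.eval] using hlK⟩
  obtain ⟨x, b⟩ := l
  cases b
  · exact hK x ⟨by simpa [Literal.eval] using hval, hl⟩
  · simp [Literal.eval, hl] at hval

end CNF

/-! ### Vertex cover formulas -/

section vertexCover

variable {X α : Type*}

open Classical in
/-- The clause expressing that one of the endpoints of an edge is selected. -/
noncomputable def edgeClause (ι : α → X) (e : Sym2 α) : Clause X :=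
  e.toFinset.image fun v => ⟨ι v, true⟩

theorem mem_edgeClause {ι : α → X} {e : Sym2 α} {l : Literal X} :
    l ∈ edgeClause ι e ↔ ∃ v ∈ e, ⟨ι v, true⟩ = l := by
  simp [edgeClause]

theorem card_edgeClause_le (ι : α → X) (e : Sym2 α) : (edgeClause ι e).card ≤ 2 := by
  classical
  refine Finset.card_image_le.trans ?_
  rw [Sym2.card_toFinset]
  split_ifs <;> omega

/-- The CNF whose models are the vertex covers of `G`. -/
noncomputable def vertexCoverCNF [Finite α] (ι : α → X) (G : SimpleGraph α) : CNF X :=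
  (Set.toFinite (edgeClause ι '' G.edgeSet)).toFinset

variable [Finite α] {G : SimpleGraph α}

theorem mem_vertexCoverCNF {ι : α → X} {K : Clause X} :
    K ∈ vertexCoverCNF ι G ↔ ∃ e ∈ G.edgeSet, edgeClause ι e = K := by
  simp [vertexCoverCNF]

theorem eval_vertexCoverCNF {ι : α → X} {f : X → Bool} :
    (vertexCoverCNF ι G).eval f = true ↔
      ∀ a b, G.Adj a b → f (ι a) = true ∨ f (ι b) = true := by
  rw [CNF.eval_eq_true_iff]
  constructor
  · intro h a b hab
    obtain ⟨l, hl, hfl⟩ := h _ (mem_vertexCoverCNF.2 ⟨s(a, b), hab, rfl⟩)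
    obtain ⟨v, hv, rfl⟩ := mem_edgeClause.1 hl
    rcases Sym2.mem_iff.1 hv with rfl | rfl
    · exact .inl (by simpa [Literal.eval] using hfl)
    · exact .inr (by simpa [Literal.eval] using hfl)
  · intro h K hK
    obtain ⟨e, he, rfl⟩ := mem_vertexCoverCNF.1 hK
    induction e using Sym2.ind with
    | _ a b =>
      rcases h a b he with h | h
      · exact ⟨_, mem_edgeClause.2 ⟨a, Sym2.mem_mk_left a b, rfl⟩, by simpa [Literal.eval] using h⟩
      · exact ⟨_, mem_edgeClause.2 ⟨b, Sym2.mem_mk_right a b, rfl⟩, by simpa [Literal.eval] using h⟩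

theorem isPI_vertexCoverCNF (ι : α ↪ X) (G : SimpleGraph α) : (vertexCoverCNF ι G).IsPI := by
  apply CNF.isPI_of_monotone
  · intro K hK l hl
    obtain ⟨e, -, rfl⟩ := mem_vertexCoverCNF.1 hK
    obtain ⟨v, -, rfl⟩ := mem_edgeClause.1 hl
    rfl
  · intro K hK K' hK' hsub
    obtain ⟨e, he, rfl⟩ := mem_vertexCoverCNF.1 hK
    obtain ⟨e', he', rfl⟩ := mem_vertexCoverCNF.1 hK'
    have hmem : ∀ v ∈ e', v ∈ e := by
      intro v hv
      obtain ⟨w, hw, hwv⟩ := mem_edgeClause.1 (hsub (mem_edgeClause.2 ⟨v, hv, rfl⟩))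
      have : ι w = ι v := congrArg Literal.var hwv
      rwa [← ι.injective this]
    induction e' using Sym2.ind with
    | _ a b =>
      have := (Sym2.mem_and_mem_iff (G.ne_of_adj he')).1
        ⟨hmem a (Sym2.mem_mk_left a b), hmem b (Sym2.mem_mk_right a b)⟩
      rw [this]

theorem size_vertexCoverCNF_le (ι : α → X) (G : SimpleGraph α) :
    (vertexCoverCNF ι G).size ≤ 3 * G.edgeSet.ncard := by
  have hcard : (vertexCoverCNF ι G).card ≤ G.edgeSet.ncard := by
    rw [vertexCoverCNF, ← Set.ncard_eq_toFinset_card _ (Set.toFinite _)]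
    exact Set.ncard_image_le (Set.toFinite _)
  calc (vertexCoverCNF ι G).size ≤ ∑ _K ∈ vertexCoverCNF ι G, 3 := by
        refine Finset.sum_le_sum fun K hK => ?_
        obtain ⟨e, -, rfl⟩ := mem_vertexCoverCNF.1 hK
        have := card_edgeClause_le ι e
        omega
    _ = 3 * (vertexCoverCNF ι G).card := by simp [mul_comm]
    _ ≤ _ := by gcongr

theorem card_le_size_vertexCoverCNF (ι : α ↪ X) {U : Finset α} (hU : ∀ a ∈ U, ∃ b, G.Adj a b) :
    U.card ≤ (vertexCoverCNF ι G).size := by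
  classical
  have hinj : Function.Injective fun v : α => (⟨ι v, true⟩ : Literal X) := fun a b h =>
    ι.injective (congrArg Literal.var h)
  calc U.card = (U.image fun v => (⟨ι v, true⟩ : Literal X)).card :=
        (Finset.card_image_of_injective _ hinj).symm
    _ ≤ ((vertexCoverCNF ι G).biUnion id).card := by
        refine Finset.card_le_card fun l hl => ?_
        obtain ⟨a, ha, rfl⟩ := Finset.mem_image.1 hl
        obtain ⟨b, hab⟩ := hU a ha
        exact Finset.mem_biUnion.2 ⟨_, mem_vertexCoverCNF.2 ⟨s(a, b), hab, rfl⟩,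
          mem_edgeClause.2 ⟨a, Sym2.mem_mk_left a b, rfl⟩⟩
    _ ≤ ∑ K ∈ vertexCoverCNF ι G, K.card := Finset.card_biUnion_le
    _ ≤ (vertexCoverCNF ι G).size := Finset.sum_le_sum fun K _ => Nat.le_succ _

end vertexCover

/-! ### The lower bound on DNNF size -/

section lowerBound

variable {X α : Type*} [Fintype α] {G : SimpleGraph α} {ι : α ↪ X} {t : ℕ} {D : NNF X}

theorem le_size_vertexCoverCNF (hα : Fintype.card α = 12 * t) (hG : G.JoinsLargeSets (2 * t)) :
    t ≤ (vertexCoverCNF ι G).size := by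
  classical
  set U : Finset α := {a | ∃ b, G.Adj a b}
  refine le_trans ?_ (card_le_size_vertexCoverCNF ι (U := U) fun a ha => by simpa [U] using ha)
  by_contra! hlt
  have hc : Uᶜ.card = 12 * t - U.card := by rw [Finset.card_compl, hα]
  obtain ⟨P, hP, hPc⟩ := Finset.exists_subset_card_eq (s := Uᶜ) (n := 2 * t) (by omega)
  have hQ : 2 * t ≤ (Pᶜ).card := by rw [Finset.card_compl]; omega
  obtain ⟨p, hp, q, -, hpq⟩ := hG P Pᶜ disjoint_compl_right hPc.ge hQ
  have : p ∉ U := Finset.mem_compl.1 (hP hp)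
  exact this (by simpa [U] using ⟨q, hpq⟩)

variable [DecidableRel G.Adj]

/-- A balanced rectangle of vertex covers of `G` forces many vertices of small degree. -/
theorem exists_forced_vertices (hα : Fintype.card α = 12 * t) (hG : G.JoinsLargeSets (2 * t))
    (hE : G.edgeFinset.card ≤ 600 * t) (hD : D.EquivalentTo (vertexCoverCNF ι G))
    {R : Set (X → Bool)} (hR : D.BalancedRect ι (4 * t) R) :
    ∃ W : Finset α, W.card = t ∧ (∀ w ∈ W, G.degree w ≤ 1200) ∧
      ∀ f ∈ R, ∀ w ∈ W, f (ι w) = true := by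
  classical
  obtain ⟨hmod, S, hS1, hS2, hrect⟩ := hR
  set H : Finset α := {v | 1200 < G.degree v}
  -- So at most `t` vertices have degree above 1200.
  have hH : 1200 * H.card ≤ 2 * (600 * t) := G.card_high_degree_le hE
  set W : Finset α := {v | G.degree v ≤ 1200 ∧ ∀ f ∈ R, f (ι v) = true}
  suffices hW : t ≤ W.card by
    obtain ⟨W', hW', hcard⟩ := Finset.exists_subset_card_eq hW
    refine ⟨W', hcard, fun w hw => ?_, fun f hf w hw => ?_⟩
    · exact (Finset.mem_filter.1 (hW' hw)).2.1
    · exact (Finset.mem_filter.1 (hW' hw)).2.2 f hf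
  by_contra! hlt
  set A : Finset α := {v | ι v ∈ S}
  have hA : weight ι S = A.card := by
    rw [weight, Set.ncard_eq_toFinset_card']
    congr 1
    ext v
    simp [A]
  have hAc : Aᶜ.card = 12 * t - A.card := by rw [Finset.card_compl, hα]
  -- Each side has at least `4 * t` vertices; `H` takes at most `t` and `W` fewer than `t`.
  have hbig : ∀ B : Finset α, 4 * t ≤ B.card → 2 * t ≤ (B \ (H ∪ W)).card := by
    intro B hB
    have h1 := Finset.le_card_sdiff (H ∪ W) B
    have h2 := Finset.card_union_le H W
    omega
  obtain ⟨p, hp, q, hq, hpq⟩ := hG (A \ (H ∪ W)) (Aᶜ \ (H ∪ W))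
    (disjoint_compl_right.mono Finset.sdiff_subset Finset.sdiff_subset)
    (hbig A (by omega)) (hbig Aᶜ (by omega))
  have hex : ∀ B : Finset α, ∀ v ∈ B \ (H ∪ W), ∃ f ∈ R, f (ι v) = false := by
    intro B v hv
    have hv := (Finset.mem_sdiff.1 hv).2
    simp only [Finset.mem_union, H, W, Finset.mem_filter, Finset.mem_univ, true_and, not_or,
      not_lt, not_and, not_forall, Bool.not_eq_true] at hv
    obtain ⟨f, hf, hfv⟩ := hv.2 hv.1
    exact ⟨f, hf, hfv⟩
  obtain ⟨f, hf, hfp⟩ := hex _ p hp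
  obtain ⟨g, hg, hgq⟩ := hex _ q hq
  have hpS : ι p ∈ S := by simpa [A] using (Finset.mem_sdiff.1 hp).1
  have hqS : ι q ∉ S := by simpa [A] using (Finset.mem_sdiff.1 hq).1
  -- The mixture agrees with `f` at `p` and with `g` at `q`, leaving the edge uncovered.
  have hh := hmod _ (hrect f hf g hg (S.piecewise f g) (Set.piecewise_eqOn S f g)
    (Set.piecewise_eqOn_compl S f g))
  rw [hD, eval_vertexCoverCNF] at hh
  have := hh p q hpq
  simp [hpS, hqS, hfp, hgq] at this

theorem pow_le_size_mul_pow {d : ℕ} (hd : 1200 = d) (ht : 0 < t) (hα : Fintype.card α = 12 * t)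
    (hG : G.JoinsLargeSets (2 * t)) (hE : G.edgeFinset.card ≤ 600 * t) (hdnnf : D.IsDNNF)
    (hD : D.EquivalentTo (vertexCoverCNF ι G)) :
    (2 ^ d + 1) ^ t ≤ (2 * D.size + 1) * (2 ^ d) ^ t := by
  classical
  obtain ⟨𝓡, hcard, hbal, hcov⟩ := NNF.exists_rectangle_cover (ι := ι) (k := 4 * t) hdnnf
    (by omega) (by rw [Nat.card_eq_fintype_card]; omega)
  -- The vertex cover complementary to `I`; variables outside the range of `ι` are set to true.
  let F : Finset α → X → Bool := fun I x => decide (∀ i ∈ I, ι i ≠ x)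
  have hF : ∀ I v, F I (ι v) = true ↔ v ∉ I := by
    intro I v
    simp only [F, decide_eq_true_eq, ne_eq, ι.injective.eq_iff]
    exact ⟨fun h hv => h v hv rfl, fun h i hi hiv => h (hiv ▸ hi)⟩
  have hsub : G.indepAvoiding ∅ ⊆ 𝓡.biUnion fun R => (G.indepAvoiding ∅).filter (F · ∈ R) := by
    intro I hI
    have hmodel : D.eval (F I) = true := by
      rw [hD, eval_vertexCoverCNF]
      intro a b hab
      rw [hF, hF]
      by_contra! hcon
      exact (SimpleGraph.mem_indepAvoiding.1 hI).1 hcon.1 hcon.2 hab.ne hab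
    obtain ⟨R, hR, hfR⟩ := hcov _ hmodel
    exact Finset.mem_biUnion.2 ⟨R, hR, Finset.mem_filter.2 ⟨hI, hfR⟩⟩
  set N := (G.indepAvoiding ∅).card
  have hN : 0 < N := Finset.card_pos.2 ⟨∅, SimpleGraph.mem_indepAvoiding.2 (by simp)⟩
  have hbound : ∀ R ∈ 𝓡, (2 ^ d + 1) ^ t * ((G.indepAvoiding ∅).filter (F · ∈ R)).card ≤
      (2 ^ d) ^ t * N := by
    intro R hR
    obtain ⟨W, hWt, hWd, hW⟩ := exists_forced_vertices hα hG hE hD (hbal R hR)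
    rw [hd] at hWd
    have hle := SimpleGraph.card_indepAvoiding_le hWd
    rw [hWt] at hle
    refine le_trans (Nat.mul_le_mul_left _ (Finset.card_le_card fun I hI => ?_)) hle
    obtain ⟨hI, hIR⟩ := Finset.mem_filter.1 hI
    refine SimpleGraph.mem_indepAvoiding.2 ⟨(SimpleGraph.mem_indepAvoiding.1 hI).1, ?_⟩
    exact Finset.disjoint_right.2 fun w hw => (hF I w).1 (hW _ hIR w hw)
  refine Nat.le_of_mul_le_mul_right ?_ hN
  calc (2 ^ d + 1) ^ t * N
      ≤ (2 ^ d + 1) ^ t * ∑ R ∈ 𝓡, ((G.indepAvoiding ∅).filter (F · ∈ R)).card :=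
        Nat.mul_le_mul_left _ ((Finset.card_le_card hsub).trans Finset.card_biUnion_le)
    _ = ∑ R ∈ 𝓡, (2 ^ d + 1) ^ t * ((G.indepAvoiding ∅).filter (F · ∈ R)).card :=
        Finset.mul_sum _ _ _
    _ ≤ ∑ _R ∈ 𝓡, (2 ^ d) ^ t * N := Finset.sum_le_sum hbound
    _ = 𝓡.card * ((2 ^ d) ^ t * N) := by simp
    _ ≤ (2 * D.size + 1) * ((2 ^ d) ^ t * N) := Nat.mul_le_mul_right _ hcard
    _ = _ := by ring

end lowerBound

/-- There are arbitrarily large CNFs in prime implicates form of size linear in `t` whose DNNFs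
all have size exponential in `t`. -/
theorem exists_isPI_hard (X : Type*) [Infinite X] :
    ∃ q : ℕ, 0 < q ∧ ∀ t, 0 < t →
      ∃ F : CNF X, F.IsPI ∧ t ≤ F.size ∧ F.size ≤ 1800 * t ∧
        ∀ D : NNF X, D.IsDNNF → D.EquivalentTo F →
          (q + 1) ^ t ≤ (2 * D.size + 1) * q ^ t := by
  -- An opaque exponent keeps `2 ^ 1200` from being computed.
  obtain ⟨d, hd⟩ : ∃ d, 1200 = d := ⟨_, rfl⟩
  refine ⟨2 ^ d, by positivity, fun t ht => ?_⟩
  classical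
  obtain ⟨G, hG, hE⟩ := SimpleGraph.exists_joinsLargeSets t ht
  let ι : Fin (12 * t) ↪ X := Fin.valEmbedding.trans (Infinite.natEmbedding X)
  have hE' : G.edgeFinset.card ≤ 600 * t := by
    rwa [SimpleGraph.edgeFinset, ← Set.ncard_eq_toFinset_card']
  refine ⟨vertexCoverCNF ι G, isPI_vertexCoverCNF ι G,
    le_size_vertexCoverCNF (Fintype.card_fin _) hG, ?_, fun D hdnnf hD =>
      pow_le_size_mul_pow hd ht (Fintype.card_fin _) hG hE' hdnnf hD⟩
  have := size_vertexCoverCNF_le ι G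
  omega

/-! ### Asymptotic form of the bound -/

theorem exists_isPI_class (X : Type*) [Infinite X] :
    ∃ (𝒞 : Set (CNF X)) (c : ℝ), 0 < c ∧ (∀ F ∈ 𝒞, F.IsPI) ∧
      (∀ n : ℕ, ∃ F ∈ 𝒞, n ≤ F.size) ∧
      (∀ F ∈ 𝒞, ∀ D : NNF X, D.IsDNNF → D.EquivalentTo F →
        (2 : ℝ) ^ (c * (F.size : ℝ)) ≤ (D.size : ℝ)) := by
  obtain ⟨q, hq0, hq⟩ := exists_isPI_hard X
  have hq0' : (0 : ℝ) < q := by exact_mod_cast hq0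
  set r : ℝ := (q + 1) / q
  have hr : 1 < r := by rw [one_lt_div hq0']; linarith
  set a := Real.logb 2 r
  have ha : 0 < a := Real.logb_pos (by norm_num) hr
  have h2a : (2 : ℝ) ^ a = r := Real.rpow_logb (by norm_num) (by norm_num) (by linarith)
  -- The class consists of all PI formulas obeying the bound, so only unbounded size needs proof.
  -- The constant 3600 is `2 * 1800`: half the exponent is given up to absorb `2 * D.size + 1`.
  refine ⟨{F | F.IsPI ∧ ∀ D : NNF X, D.IsDNNF → D.EquivalentTo F →
    (2 : ℝ) ^ (a / 3600 * (F.size : ℝ)) ≤ (D.size : ℝ)}, a / 3600, by positivity,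
    fun F hF => hF.1, fun n => ?_, fun F hF => hF.2⟩
  obtain ⟨t₀, ht₀⟩ := exists_nat_ge (4 / a)
  obtain ⟨F, hPI, hn, hsize, hF⟩ := hq (max n (t₀ + 1)) (by omega)
  generalize htdef : max n (t₀ + 1) = t at *
  refine ⟨F, ⟨hPI, fun D hdnnf hD => ?_⟩, by omega⟩
  have hb := hF D hdnnf hD
  have hb' : ((q : ℝ) + 1) ^ t ≤ (2 * D.size + 1) * (q : ℝ) ^ t := by exact_mod_cast hb
  have hrt : r ^ t ≤ 2 * D.size + 1 := by
    rw [div_pow, div_le_iff₀ (by positivity)]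
    exact hb'
  -- From `y * y ≤ 2 * D.size + 1` and `4 ≤ y` follows `y ≤ D.size`; `t₀` is chosen to ensure `4 ≤
  -- y`.
  set y : ℝ := 2 ^ (a * t / 2)
  have hy2 : y * y = r ^ t := by
    rw [← Real.rpow_add (by norm_num), ← h2a, ← Real.rpow_natCast, ← Real.rpow_mul (by norm_num)]
    ring_nf
  have ht4 : 4 ≤ a * t := by
    have : (t₀ : ℝ) ≤ t := by exact_mod_cast (by omega : t₀ ≤ t)
    have := ht₀.trans this
    rw [div_le_iff₀ ha] at this
    linarith
  have hy4 : 4 ≤ y := by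
    calc (4 : ℝ) = 2 ^ (2 : ℝ) := by norm_num
      _ ≤ y := Real.rpow_le_rpow_of_exponent_le (by norm_num) (by linarith)
  calc (2 : ℝ) ^ (a / 3600 * (F.size : ℝ)) ≤ y := by
        apply Real.rpow_le_rpow_of_exponent_le (by norm_num)
        have : (F.size : ℝ) ≤ 1800 * t := by exact_mod_cast hsize
        nlinarith
    _ ≤ D.size := by nlinarith

theorem eventually_polynomial_lt_two_rpow (p : Polynomial ℕ) {c : ℝ} (hc : 0 < c) :
    ∀ᶠ n : ℕ in Filter.atTop, ((p.eval n : ℕ) : ℝ) < 2 ^ (c * n) := by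
  have hb : 0 < c * Real.log 2 := mul_pos hc (Real.log_pos (by norm_num))
  -- Rescaling the variable turns `2 ^ (c * n)` into `exp` at the point where `P` is evaluated.
  let P : Polynomial ℝ :=
    (p.map (Nat.castRingHom ℝ)).comp (Polynomial.C (c * Real.log 2)⁻¹ * Polynomial.X)
  have hlim : Filter.Tendsto (fun n : ℕ => c * Real.log 2 * n) Filter.atTop Filter.atTop :=
    tendsto_natCast_atTop_atTop.const_mul_atTop hb
  have h := (P.tendsto_div_exp_atTop.comp hlim).eventually (gt_mem_nhds one_pos)
  filter_upwards [h] with n hn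
  have hP : P.eval (c * Real.log 2 * n) = ((p.eval n : ℕ) : ℝ) := by
    simp only [P, Polynomial.eval_comp, Polynomial.eval_mul, Polynomial.eval_C, Polynomial.eval_X]
    rw [inv_mul_cancel_left₀ hb.ne', Polynomial.eval_natCast_map]
    rfl
  rw [Function.comp_apply, hP, div_lt_one (Real.exp_pos _)] at hn
  rw [Real.rpow_def_of_pos (by norm_num), mul_left_comm, ← mul_assoc]
  exact hn

theorem mainTheorem3 (X : Type*) [Countable X] [Infinite X] :
    (∃ (𝒞 : Set (CNF X)) (c : ℝ), 0 < c ∧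
      (∀ F ∈ 𝒞, F.IsPI) ∧
      (∀ n : ℕ, ∃ F ∈ 𝒞, n ≤ F.size) ∧
      (∀ F ∈ 𝒞, ∀ D : NNF X, D.IsDNNF → D.EquivalentTo F →
        (2 : ℝ) ^ (c * (F.size : ℝ)) ≤ (D.size : ℝ))) ∧
    ¬ ∃ p : Polynomial ℕ, ∀ F : CNF X, F.IsPI →
      ∃ D : NNF X, D.IsDNNF ∧ D.EquivalentTo F ∧ D.size ≤ p.eval F.size := by
  have hclass := exists_isPI_class X
  refine ⟨hclass, ?_⟩
  rintro ⟨p, hp⟩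
  obtain ⟨𝒞, c, hc, hPI, hlarge, hbound⟩ := hclass
  obtain ⟨n, hn⟩ := Filter.eventually_atTop.1 (eventually_polynomial_lt_two_rpow p hc)
  obtain ⟨F, hF, hnF⟩ := hlarge n
  obtain ⟨D, hdnnf, hD, hsize⟩ := hp F (hPI F hF)
  have h1 := hbound F hF D hdnnf hD
  have h2 := hn F.size hnF
  have h3 : (D.size : ℝ) ≤ (p.eval F.size : ℕ) := by exact_mod_cast hsize
  linarith
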